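/- **Definitions.** Let $(\Omega,\mu)$ be a probability space. A *P-operator* on $\Omega$ is a bounded linear operator $A:L^\infty(\Omega)\to L^1(\Omega)$ (real-valued functions). For $p,q\in[1,\infty]$ put $$\|A\|_{p\to q}=\sup_{0\ne v\in L^\infty(\Omega)}\frac{\|Av\|_q}{\|v\|_p}\in[0,\infty].$$ $A$ is *self-adjoint* if $\int_\Omega (Av)\,u\,d\mu=\int_\Omega (Au)\,v\,d\mu$ for all $u,v\in L^\infty(\Omega)$, and *positively preserving* if $Av\ge 0$ a.e. whenever $v\in L^\infty(\Omega)$ and $v\ge0$ a.e. A *graphop* is a self-adjoint, positively preserving P-operator. A *P-operator-signal* (respectively *graphop-signal*) with feature dimension $d\ge 0$ is a pair $(A,f)$ of a P-operator (respectively graphop) $A$ on $\Omega$ and a measurable $f:\Omega\to[-1,1]^d$. Let $\mathcal B^r_{p,q,d}(\Omega)$ and $\mathscr G^r_{p,q,d}(\Omega)$ be the sets of P-operator-signals and of graphop-signals, respectively, with $\|A\|_{p\to q}\le r$. For $k\ge0$, the *$k$-profile* $\mathrm S_k(A,f)$ is the set of the joint distributions, on $\mathbb R^{2k+d}$, of $(v_1,\dots,v_k,Av_1,\dots,Av_k,f)$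 under $\mu$, where $v_1,\dots,v_k$ range over all measurable functions $\Omega\to[-1,1]$. Let $d_H$ denote the Hausdorff distance between sets of probability measures on $\mathbb R^{2k+d}$ with respect to the Wasserstein distance of order $1$ for the $\ell^1$-norm. P-operator-signals $(A_n,f_n)$ on probability spaces $\Omega_n$ *action converge* to a P-operator-signal $(A,f)$ on $\Omega$ if $d_H(\mathrm S_k(A_n,f_n),\mathrm S_k(A,f))\to0$ for every $k\ge 0$. (This holds in particular if $\sum_{k\ge0}2^{-k}d_H(\mathrm S_k(A_n,f_n),\mathrm S_k(A,f))\to0$, i.e. if they converge in the action metric.) **Theorem.** Let $p\in[1,\infty]$, $q\in(1,\infty]$, $d\in\mathbb N_0$ and $r>0$. Let $(\Omega_n,\mu_n)_{n\in\mathbb N}$ and $(\Omega,\mu)$ be probability spaces, and let $(A_n,f_n)\in\mathscr G^r_{p,q,d}(\Omega_n)$ be a sequence of graphop-signals that action converges to a P-operator-signal $(A,f)\in\mathcal B^r_{p,q,d}(\Omega)$. Then $(A,f)\in\mathscr G^r_{p,q,d}(\Omega)$. That is, $A$ is again self-adjoint and positively preserving, and an action limit of graphop-signals is itself a graphop-signal.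 -/

import Mathlib

open MeasureTheory Filter Topology
open scoped ENNReal

/-- The index set of the coordinates of `ℝ^(2k+d)`: first `k` coordinates for `v₁, …, v_k`, then
`k` coordinates for `Av₁, …, Av_k`, then `d` coordinates for the signal. -/
abbrev ProfileIndex (k d : ℕ) : Type := Fin k ⊕ Fin k ⊕ Fin d

/-- The `ℓ¹` distance on `ℝ^ι`, with values in `[0, ∞]`. -/
noncomputable def l1EDist {ι : Type*} [Fintype ι] (x y : ι → ℝ) : ℝ≥0∞ :=
  ∑ i, ENNReal.ofReal |x i - y i|

/-- The couplings of two measures on `ℝ^ι`: measures on the product with the given marginals. -/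
def couplings {ι : Type*} (ν₁ ν₂ : Measure (ι → ℝ)) : Set (Measure ((ι → ℝ) × (ι → ℝ))) :=
  {γ | γ.map Prod.fst = ν₁ ∧ γ.map Prod.snd = ν₂}

/-- The Wasserstein distance of order `1` with respect to the `ℓ¹` distance
(possibly infinite). -/
noncomputable def wassersteinDist {ι : Type*} [Fintype ι] (ν₁ ν₂ : Measure (ι → ℝ)) : ℝ≥0∞ :=
  ⨅ γ ∈ couplings ν₁ ν₂, ∫⁻ z, l1EDist z.1 z.2 ∂γ

/-- The Hausdorff distance of two sets of measures on `ℝ^ι`, with respect to the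
Wasserstein distance. -/
noncomputable def profileHausdorffDist {ι : Type*} [Fintype ι]
    (S₁ S₂ : Set (Measure (ι → ℝ))) : ℝ≥0∞ :=
  max (⨆ ν₁ ∈ S₁, ⨅ ν₂ ∈ S₂, wassersteinDist ν₁ ν₂)
    (⨆ ν₂ ∈ S₂, ⨅ ν₁ ∈ S₁, wassersteinDist ν₁ ν₂)

/-- A P-operator: a bounded linear operator from `L^∞(Ω)` to `L¹(Ω)`. -/
abbrev POperator {Ω : Type*} [MeasurableSpace Ω] (μ : Measure Ω) : Type _ :=
  Lp ℝ ∞ μ →L[ℝ] Lp ℝ 1 μ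

/-- A P-operator-signal: a P-operator together with a measurable `f : Ω → [-1,1]^d`. -/
structure POperatorSignal {Ω : Type*} [MeasurableSpace Ω] (μ : Measure Ω) (d : ℕ) where
  op : POperator μ
  signal : Ω → Fin d → ℝ
  measurable_signal : Measurable signal
  signal_mem : ∀ ω i, signal ω i ∈ Set.Icc (-1 : ℝ) 1

namespace POperator

variable {Ω : Type*} [MeasurableSpace Ω] {μ : Measure Ω}

/-- The `(p,q)`-norm `‖A‖_{p→q} = sup {‖Av‖_q / ‖v‖_p : 0 ≠ v ∈ L^∞(Ω)}` (possibly infinite). -/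
noncomputable def pqNorm (A : POperator μ) (p q : ℝ≥0∞) : ℝ≥0∞ :=
  ⨆ (v : Lp ℝ ∞ μ) (_ : v ≠ 0), eLpNorm (A v) q μ / eLpNorm v p μ

/-- The bilinear form `(v,u)_A = ∫ (Av) u dμ`. -/
noncomputable def form (A : POperator μ) (v u : Lp ℝ ∞ μ) : ℝ :=
  ∫ ω, A v ω * u ω ∂μ

def IsSelfAdjoint (A : POperator μ) : Prop :=
  ∀ u v : Lp ℝ ∞ μ, A.form v u = A.form u v

def IsPositivelyPreserving (A : POperator μ) : Prop :=
  ∀ v : Lp ℝ ∞ μ, (∀ᵐ ω ∂μ, 0 ≤ v ω) → ∀ᵐ ω ∂μ, 0 ≤ A v ω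

/-- A graphop: a self-adjoint, positively preserving P-operator. -/
structure IsGraphop (A : POperator μ) : Prop where
  isSelfAdjoint : A.IsSelfAdjoint
  isPositivelyPreserving : A.IsPositivelyPreserving

end POperator

/-- The measurable functions `v : Ω → [-1,1]`. -/
def ProfileInput (Ω : Type*) [MeasurableSpace Ω] : Type _ :=
  {v : Ω → ℝ // Measurable v ∧ ∀ ω, v ω ∈ Set.Icc (-1 : ℝ) 1}

namespace ProfileInput

variable {Ω : Type*} [MeasurableSpace Ω]

theorem memLp_top (v : ProfileInput Ω) (μ : Measure Ω) : MemLp v.1 ∞ μ :=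
  memLp_top_of_bound v.2.1.aestronglyMeasurable 1
    (ae_of_all _ fun ω => abs_le.2 (v.2.2 ω))

/-- The class of `v` in `L^∞(Ω)`. -/
noncomputable def toLinfty (v : ProfileInput Ω) (μ : Measure Ω) : Lp ℝ ∞ μ :=
  (v.memLp_top μ).toLp v.1

end ProfileInput

namespace POperatorSignal

variable {Ω : Type*} [MeasurableSpace Ω] {μ : Measure Ω} {d : ℕ}

/-- The P-distribution of `(A, f)` with respect to `v₁, …, v_k`: the joint distribution of
`v₁, …, v_k, Av₁, …, Av_k, f` on `ℝ^(2k+d)`. -/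
noncomputable def pDistribution (X : POperatorSignal μ d) {k : ℕ} (v : Fin k → ProfileInput Ω) :
    Measure (ProfileIndex k d → ℝ) :=
  μ.map fun ω => Sum.elim (fun i => (v i).1 ω)
    (Sum.elim (fun i => X.op ((v i).toLinfty μ) ω) (X.signal ω))

/-- The `k`-profile of `(A, f)`: the set of all its P-distributions of order `k`. -/
def profile (X : POperatorSignal μ d) (k : ℕ) : Set (Measure (ProfileIndex k d → ℝ)) :=
  Set.range fun v : Fin k → ProfileInput Ω => X.pDistribution v

end POperatorSignal

/-- The P-operator-signals `(A, f)` over `(Ω, μ)` with feature dimension `d` and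
`‖A‖_{p→q} ≤ r`. -/
def boundedPOperatorSignals {Ω : Type*} [MeasurableSpace Ω] (μ : Measure Ω) (p q : ℝ≥0∞) (d : ℕ)
    (r : ℝ) : Set (POperatorSignal μ d) :=
  {X | X.op.pqNorm p q ≤ ENNReal.ofReal r}

/-- The graphop-signals `(A, f)` over `(Ω, μ)` with feature dimension `d` and
`‖A‖_{p→q} ≤ r`. -/
def boundedGraphopSignals {Ω : Type*} [MeasurableSpace Ω] (μ : Measure Ω) (p q : ℝ≥0∞) (d : ℕ)
    (r : ℝ) : Set (POperatorSignal μ d) :=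
  {X | X.op.IsGraphop ∧ X.op.pqNorm p q ≤ ENNReal.ofReal r}

/-- The action metric between P-operator-signals, which may live over different spaces. -/
noncomputable def actionDist {Ω₁ Ω₂ : Type*} [MeasurableSpace Ω₁] [MeasurableSpace Ω₂]
    {μ₁ : Measure Ω₁} {μ₂ : Measure Ω₂} {d : ℕ}
    (X : POperatorSignal μ₁ d) (Y : POperatorSignal μ₂ d) : ℝ≥0∞ :=
  ∑' k : ℕ, (2 : ℝ≥0∞)⁻¹ ^ k * profileHausdorffDist (X.profile k) (Y.profile k)

/-- Action convergence of a sequence of P-operator-signals to a P-operator-signal: for every `k`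
the `k`-profiles converge in the Hausdorff distance. -/
def ActionConvergesTo {Ω' : ℕ → Type*} [∀ n, MeasurableSpace (Ω' n)] {μ' : ∀ n, Measure (Ω' n)}
    {Ω : Type*} [MeasurableSpace Ω] {μ : Measure Ω} {d : ℕ}
    (X : ∀ n, POperatorSignal (μ' n) d) (Y : POperatorSignal μ d) : Prop :=
  ∀ k : ℕ, Tendsto (fun n => profileHausdorffDist ((X n).profile k) (Y.profile k)) atTop (𝓝 0)

/-- Convergence in the action metric implies action convergence. -/
theorem ActionConvergesTo.of_tendsto_actionDist {Ω' : ℕ → Type*} [∀ n, MeasurableSpace (Ω' n)]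
    {μ' : ∀ n, Measure (Ω' n)} {Ω : Type*} [MeasurableSpace Ω] {μ : Measure Ω} {d : ℕ}
    (X : ∀ n, POperatorSignal (μ' n) d) (Y : POperatorSignal μ d)
    (h : Tendsto (fun n => actionDist (X n) Y) atTop (𝓝 0)) : ActionConvergesTo X Y := by
  intro k
  have h2 : Tendsto (fun n => (2 : ℝ≥0∞) ^ k * actionDist (X n) Y) atTop (𝓝 0) := by
    simpa using ENNReal.Tendsto.const_mul h (Or.inr (ENNReal.pow_ne_top (n := k) ENNReal.ofNat_ne_top))
  refine tendsto_of_tendsto_of_tendsto_of_le_of_le tendsto_const_nhds h2 (fun _ => zero_le) fun n => ?_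
  have h3 : (2 : ℝ≥0∞)⁻¹ ^ k * profileHausdorffDist ((X n).profile k) (Y.profile k) ≤
      actionDist (X n) Y :=
    ENNReal.le_tsum (f := fun k : ℕ => (2 : ℝ≥0∞)⁻¹ ^ k *
      profileHausdorffDist ((X n).profile k) (Y.profile k)) k
  calc profileHausdorffDist ((X n).profile k) (Y.profile k)
      = 2 ^ k * ((2 : ℝ≥0∞)⁻¹ ^ k * profileHausdorffDist ((X n).profile k) (Y.profile k)) := by
        rw [← mul_assoc, ← mul_pow, ENNReal.mul_inv_cancel (by norm_num) (by norm_num),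
          one_pow, one_mul]
    _ ≤ _ := by gcongr

/-! Both graphop properties can be tested on finitely many functions with values in `[-1,1]`,
through integrals of expressions in `v` and `Av`. Such integrals depend only on the joint
distribution, so they can be compared along couplings of small `L¹` cost.

Self-adjointness: take `u` and `v` in one 2-profile. The product `(Av)u` is not Lipschitz because
`Av` is unbounded, but truncating at a level `K` costs only a tail of the limit function `Av`, which
is fixed before the approximation is chosen (`abs_integral_mul_sub_integral_mul_le`).

Positivity: an approximant `u` of some `v ≥ 0` may be negative, but its negative part `u⁻` has small
integral. Positivity, self-adjointness and Hölder give `∫ (Au)⁻ ≤ ∫ A(u⁻) = ∫ (A1) u⁻ ≤ r (∫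
u⁻)^(1/t)` with `t < ∞`, which is where `q > 1` enters (`IsGraphop.integral_max_neg_apply_le`).
Hence `(Av)⁻` has integral zero in the limit. -/

theorem lintegral_l1EDist_lt_of_profileHausdorffDist_lt {ι : Type*} [Fintype ι]
    {S₁ S₂ : Set (Measure (ι → ℝ))} {δ : ℝ≥0∞} (h : profileHausdorffDist S₁ S₂ < δ)
    {ν₂ : Measure (ι → ℝ)} (hν : ν₂ ∈ S₂) :
    ∃ ν₁ ∈ S₁, ∃ γ ∈ couplings ν₁ ν₂, ∫⁻ z, l1EDist z.1 z.2 ∂γ < δ := by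
  have h1 : (⨅ ν₁ ∈ S₁, wassersteinDist ν₁ ν₂) < δ :=
    ((le_iSup₂ (f := fun ν₂ (_ : ν₂ ∈ S₂) => ⨅ ν₁ ∈ S₁, wassersteinDist ν₁ ν₂) ν₂ hν).trans
      (le_max_right _ _)).trans_lt h
  simp only [wassersteinDist, iInf_lt_iff] at h1
  obtain ⟨ν₁, h₁, γ, hγ, hlt⟩ := h1
  exact ⟨ν₁, h₁, γ, hγ, hlt⟩

/-- Integrable functions have small integral above a high level. -/
theorem exists_integral_max_abs_sub_le {α : Type*} [MeasurableSpace α] {μ : Measure α}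
    {g : α → ℝ} (hg : Integrable g μ) {ε : ℝ} (hε : 0 < ε) :
    ∃ K : ℝ, 0 ≤ K ∧ ∫ x, max (|g x| - K) 0 ∂μ ≤ ε := by
  have h : Tendsto (fun n : ℕ => ∫ x, max (|g x| - n) 0 ∂μ) atTop (𝓝 (∫ _, (0 : ℝ) ∂μ)) := by
    refine tendsto_integral_of_dominated_convergence (fun x => |g x|) (fun n => ?_) hg.abs
      (fun n => ae_of_all _ fun x => ?_) (ae_of_all _ fun x => ?_)
    · have := hg.aestronglyMeasurable.aemeasurable
      exact AEMeasurable.aestronglyMeasurable (by fun_prop)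
    · rw [Real.norm_of_nonneg (le_max_right _ _)]
      exact max_le (by simp) (abs_nonneg _)
    · refine tendsto_const_nhds.congr' ?_
      filter_upwards [eventually_ge_atTop ⌈|g x|⌉₊] with n hn
      exact (max_eq_right (sub_nonpos.2 (Nat.ceil_le.1 hn))).symm
  rw [integral_zero] at h
  obtain ⟨n, hn⟩ := (h.eventually (gt_mem_nhds hε)).exists
  exact ⟨n, n.cast_nonneg, hn.le⟩

/-- Products with one factor bounded are stable under `L¹`-perturbation of both factors, up to the
tail of the unperturbed factor. -/
theorem abs_integral_mul_sub_integral_mul_le {α : Type*} [MeasurableSpace α] {γ : Measure α}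
    {a b a' b' : α → ℝ} (ha : Integrable a γ) (ha' : Integrable a' γ)
    (hb : Integrable b γ) (hb' : Integrable b' γ)
    (hb1 : ∀ᵐ x ∂γ, |b x| ≤ 1) (hb1' : ∀ᵐ x ∂γ, |b' x| ≤ 1) (K : ℝ) [IsFiniteMeasure γ] :
    |∫ x, a x * b x ∂γ - ∫ x, a' x * b' x ∂γ| ≤
      ∫ x, |a x - a' x| ∂γ + K * ∫ x, |b x - b' x| ∂γ + 2 * ∫ x, max (|a' x| - K) 0 ∂γ := by
  have hab : Integrable (fun x => a x * b x) γ :=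
    ha.mul_bdd hb.aestronglyMeasurable hb1
  have hab' : Integrable (fun x => a' x * b' x) γ :=
    ha'.mul_bdd hb'.aestronglyMeasurable hb1'
  have hm : Integrable (fun x => max (|a' x| - K) 0) γ :=
    (ha'.abs.sub (integrable_const K)).pos_part
  have i1 : Integrable (fun x => |a x - a' x|) γ := (ha.sub ha').abs
  have i2 : Integrable (fun x => K * |b x - b' x|) γ := (hb.sub hb').abs.const_mul K
  have i3 := hm.const_mul 2
  have i12 : Integrable (fun x => |a x - a' x| + K * |b x - b' x|) γ := i1.add i2
  rw [← integral_sub hab hab', ← integral_const_mul, ← integral_const_mul, ← integral_add i1 i2,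
    ← integral_add i12 i3]
  refine abs_integral_le_integral_abs.trans
    (integral_mono_ae (hab.sub hab').abs (i12.add i3) ?_)
  filter_upwards [hb1, hb1'] with x h1 h2
  have e : a x * b x - a' x * b' x = (a x - a' x) * b x + a' x * (b x - b' x) := by ring
  have hd : |b x - b' x| ≤ 2 := (abs_sub _ _).trans (by linarith)
  have t1 : |(a x - a' x) * b x| ≤ |a x - a' x| := by
    rw [abs_mul]; exact mul_le_of_le_one_right (abs_nonneg _) h1
  -- Split `|a'| ≤ K + max (|a'| - K) 0`, and bound `|b - b'|` by 2 on the excess.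
  have t2 : |a' x * (b x - b' x)| ≤ K * |b x - b' x| + 2 * max (|a' x| - K) 0 := by
    rw [abs_mul]
    have := le_max_left (|a' x| - K) 0
    have := le_max_right (|a' x| - K) 0
    nlinarith [abs_nonneg (b x - b' x)]
  simp only [e]
  refine (abs_add_le _ _).trans ?_
  linarith

/-- The negative part is a 1-Lipschitz function. -/
theorem integral_max_neg_le {α : Type*} [MeasurableSpace α] {γ : Measure α}
    {a b : α → ℝ} (ha : Integrable a γ) (hb : Integrable b γ) :
    ∫ x, max (-a x) 0 ∂γ ≤ ∫ x, max (-b x) 0 ∂γ + ∫ x, |a x - b x| ∂γ := by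
  have i1 : Integrable (fun x => max (-b x) 0) γ := hb.neg.pos_part
  have i2 : Integrable (fun x => |a x - b x|) γ := (ha.sub hb).abs
  rw [← integral_add i1 i2]
  refine integral_mono ha.neg.pos_part (i1.add i2) fun x => ?_
  have := neg_abs_le (a x - b x)
  have := le_max_left (-b x) 0
  have := le_max_right (-b x) 0
  exact max_le (by linarith) (add_nonneg this (abs_nonneg _))

/-! ### Test functions with values in `[-1,1]` -/

namespace ProfileInput

variable {Ω : Type*} [MeasurableSpace Ω]

theorem coeFn_toLinfty (v : ProfileInput Ω) (μ : Measure Ω) : v.toLinfty μ =ᵐ[μ] v.1 :=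
  (v.memLp_top μ).coeFn_toLp

theorem abs_le_one (v : ProfileInput Ω) (ω : Ω) : |v.1 ω| ≤ 1 := abs_le.2 (v.2.2 ω)

theorem integrable (v : ProfileInput Ω) (μ : Measure Ω) [IsFiniteMeasure μ] : Integrable v.1 μ :=
  (v.memLp_top μ).integrable le_top

/-- The constant function `1`. -/
def one (Ω : Type*) [MeasurableSpace Ω] : ProfileInput Ω :=
  ⟨fun _ => 1, measurable_const, fun _ => by norm_num⟩

def posPart (v : ProfileInput Ω) : ProfileInput Ω :=
  ⟨fun ω => max (v.1 ω) 0, v.2.1.max measurable_const, fun ω =>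
    ⟨by linarith [le_max_right (v.1 ω) 0], max_le (v.2.2 ω).2 zero_le_one⟩⟩

def negPart (v : ProfileInput Ω) : ProfileInput Ω :=
  ⟨fun ω => max (-v.1 ω) 0, v.2.1.neg.max measurable_const, fun ω =>
    ⟨by linarith [le_max_right (-v.1 ω) 0], max_le (by linarith [(v.2.2 ω).1]) zero_le_one⟩⟩

theorem toLinfty_eq_posPart_sub_negPart (v : ProfileInput Ω) (μ : Measure Ω) :
    v.toLinfty μ = v.posPart.toLinfty μ - v.negPart.toLinfty μ := by
  apply Lp.ext
  filter_upwards [v.coeFn_toLinfty μ, v.posPart.coeFn_toLinfty μ, v.negPart.coeFn_toLinfty μ,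
    Lp.coeFn_sub (v.posPart.toLinfty μ) (v.negPart.toLinfty μ)] with ω h h1 h2 h3
  rw [h, h3, Pi.sub_apply, h1, h2]
  simp only [posPart, negPart]
  rcases le_total 0 (v.1 ω) with hv | hv
  · rw [max_eq_left hv, max_eq_right (by linarith), sub_zero]
  · rw [max_eq_right hv, max_eq_left (by linarith), zero_sub, neg_neg]

/-- Every element of `L^∞` is a positive multiple of the class of a function with values in
`[-1,1]`. -/
theorem exists_eq_smul_toLinfty {μ : Measure Ω} (v : Lp ℝ ∞ μ) :
    ∃ (c : ℝ) (w : ProfileInput Ω), 0 < c ∧ v = c • w.toLinfty μ := by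
  -- The `+ 1` keeps the scale positive when `v = 0`. The clamp below changes `v` only on a null
  -- set, but makes the bound hold everywhere.
  have hc : 0 < ‖v‖ + 1 := by positivity
  have hm : Measurable fun ω => max (-1) (min 1 ((‖v‖ + 1)⁻¹ * v ω)) := by
    have := (Lp.stronglyMeasurable v).measurable
    fun_prop
  have hb : ∀ ω, max (-1) (min 1 ((‖v‖ + 1)⁻¹ * v ω)) ∈ Set.Icc (-1 : ℝ) 1 := fun ω =>
    ⟨le_max_left _ _, max_le (by norm_num) (min_le_left _ _)⟩
  let w : ProfileInput Ω := ⟨fun ω => max (-1) (min 1 ((‖v‖ + 1)⁻¹ * v ω)), hm, hb⟩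
  exact ⟨‖v‖ + 1, w, hc, by
    apply Lp.ext
    have hv : ∀ᵐ ω ∂μ, ‖v ω‖ ≤ ‖v‖ := by
      have h := enorm_ae_le_eLpNormEssSup v μ
      filter_upwards [h] with ω hω
      rw [Lp.norm_def, eLpNorm_exponent_top, ← toReal_enorm]
      refine ENNReal.toReal_mono ?_ hω
      rw [← eLpNorm_exponent_top]
      exact Lp.eLpNorm_ne_top v
    filter_upwards [hv, Lp.coeFn_smul (‖v‖ + 1) (w.toLinfty μ), w.coeFn_toLinfty μ] with ω h1 h2 h3
    rw [h2, Pi.smul_apply, h3, smul_eq_mul]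
    simp only [w]
    have h4 : |(‖v‖ + 1)⁻¹ * v ω| ≤ 1 := by
      rw [abs_mul, abs_of_pos (inv_pos.2 hc), inv_mul_le_iff₀ hc]
      rw [Real.norm_eq_abs] at h1
      linarith
    rw [min_eq_right (abs_le.1 h4).2, max_eq_right (abs_le.1 h4).1, mul_inv_cancel_left₀ hc.ne']⟩

end ProfileInput

/-! ### Reduction to test functions, and quantitative positivity -/

namespace POperator

variable {Ω : Type*} [MeasurableSpace Ω] {μ : Measure Ω}

theorem form_smul_smul (A : POperator μ) (c d : ℝ) (v u : Lp ℝ ∞ μ) :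
    A.form (c • v) (d • u) = c * d * A.form v u := by
  simp only [form, map_smul]
  rw [← integral_const_mul]
  refine integral_congr_ae ?_
  filter_upwards [Lp.coeFn_smul c (A v), Lp.coeFn_smul d u] with ω h1 h2
  rw [h1, h2]
  simp only [Pi.smul_apply, smul_eq_mul]
  ring

theorem form_toLinfty (A : POperator μ) (v : Lp ℝ ∞ μ) (u : ProfileInput Ω) :
    A.form v (u.toLinfty μ) = ∫ ω, A v ω * u.1 ω ∂μ :=
  integral_congr_ae (by filter_upwards [u.coeFn_toLinfty μ] with ω h; rw [h])

theorem isSelfAdjoint_of_profileInput {A : POperator μ}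
    (h : ∀ u v : ProfileInput Ω,
      A.form (v.toLinfty μ) (u.toLinfty μ) = A.form (u.toLinfty μ) (v.toLinfty μ)) :
    A.IsSelfAdjoint := by
  intro u v
  obtain ⟨c, u, -, rfl⟩ := ProfileInput.exists_eq_smul_toLinfty u
  obtain ⟨c', v, -, rfl⟩ := ProfileInput.exists_eq_smul_toLinfty v
  rw [form_smul_smul, form_smul_smul, h u v, mul_comm c c']

theorem isPositivelyPreserving_of_profileInput {A : POperator μ}
    (h : ∀ v : ProfileInput Ω, (∀ᵐ ω ∂μ, 0 ≤ v.1 ω) → ∀ᵐ ω ∂μ, 0 ≤ A (v.toLinfty μ) ω) :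
    A.IsPositivelyPreserving := by
  intro v hv
  obtain ⟨c, w, hc, rfl⟩ := ProfileInput.exists_eq_smul_toLinfty v
  rw [map_smul]
  have hw : ∀ᵐ ω ∂μ, 0 ≤ w.1 ω := by
    filter_upwards [hv, Lp.coeFn_smul c (w.toLinfty μ), w.coeFn_toLinfty μ] with ω h1 h2 h3
    rw [h2, Pi.smul_apply, h3, smul_eq_mul] at h1
    exact (mul_nonneg_iff_of_pos_left hc).1 h1
  filter_upwards [h w hw, Lp.coeFn_smul c (A (w.toLinfty μ))] with ω h1 h2
  rw [h2]
  exact mul_nonneg hc.le h1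

theorem integrable_apply (A : POperator μ) (v : Lp ℝ ∞ μ) : Integrable (A v) μ :=
  L1.integrable_coeFn (A v)

/-- On a probability space the constant 1 has `p`-norm 1, so it is an admissible test vector for
every `p`. -/
theorem eLpNorm_apply_one_le [IsProbabilityMeasure μ] (A : POperator μ) {p q : ℝ≥0∞}
    (hp : 1 ≤ p) {C : ℝ≥0∞} (h : A.pqNorm p q ≤ C) :
    eLpNorm (A ((ProfileInput.one Ω).toLinfty μ)) q μ ≤ C := by
  have e : eLpNorm ((ProfileInput.one Ω).toLinfty μ) p μ = 1 := by
    rw [eLpNorm_congr_ae ((ProfileInput.one Ω).coeFn_toLinfty μ)]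
    simp [ProfileInput.one, eLpNorm_const _ (zero_lt_one.trans_le hp).ne'
      (IsProbabilityMeasure.ne_zero μ)]
  have hne : (ProfileInput.one Ω).toLinfty μ ≠ 0 := by
    intro h0
    rw [h0, eLpNorm_congr_ae (Lp.coeFn_zero ..), eLpNorm_zero] at e
    exact zero_ne_one e
  have := (le_iSup₂ (f := fun (v : Lp ℝ ∞ μ) (_ : v ≠ 0) => eLpNorm (A v) q μ / eLpNorm v p μ)
    _ hne).trans h
  rwa [e, div_one] at this

/-- For a graphop with `‖A‖_{p→q} ≤ r` and `q > 1`, the integral of the negative part of `Au` is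
controlled by the integral of the negative part of `u`. -/
theorem IsGraphop.integral_max_neg_apply_le [IsProbabilityMeasure μ] {A : POperator μ}
    (hA : A.IsGraphop) {p q : ℝ≥0∞} (hp : 1 ≤ p) {r : ℝ} (hr : 0 ≤ r)
    (h : A.pqNorm p q ≤ ENNReal.ofReal r) {s t : ℝ} (hst : s.HolderConjugate t)
    (hs : ENNReal.ofReal s ≤ q) (u : ProfileInput Ω) :
    ∫ ω, max (-A (u.toLinfty μ) ω) 0 ∂μ ≤ r * (∫ ω, max (-u.1 ω) 0 ∂μ) ^ (1 / t) := by
  set P := u.posPart.toLinfty μ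
  set N := u.negPart.toLinfty μ with hN
  set E := (ProfileInput.one Ω).toLinfty μ with hE
  have nonneg : ∀ w : ProfileInput Ω, (∀ ω, 0 ≤ w.1 ω) → ∀ᵐ ω ∂μ, 0 ≤ A (w.toLinfty μ) ω :=
    fun w hw => hA.isPositivelyPreserving _
      (by filter_upwards [w.coeFn_toLinfty μ] with ω h; rw [h]; exact hw ω)
  have hPp : ∀ᵐ ω ∂μ, 0 ≤ A P ω := nonneg _ fun ω => le_max_right _ _
  have hNp : ∀ᵐ ω ∂μ, 0 ≤ A N ω := nonneg _ fun ω => le_max_right _ _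
  have hEp : ∀ᵐ ω ∂μ, 0 ≤ A E ω := nonneg _ fun ω => zero_le_one
  have h1 : ∫ ω, max (-A (u.toLinfty μ) ω) 0 ∂μ ≤ ∫ ω, A N ω ∂μ := by
    refine integral_mono_ae (A.integrable_apply _).neg.pos_part (A.integrable_apply _) ?_
    rw [u.toLinfty_eq_posPart_sub_negPart, map_sub]
    filter_upwards [hPp, hNp, Lp.coeFn_sub (A P) (A N)] with ω h1 h2 h3
    rw [h3, Pi.sub_apply]
    exact max_le (by linarith) h2
  -- Pair `A N` with 1 and move `A` across by self-adjointness.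
  have h2 : ∫ ω, A N ω ∂μ = ∫ ω, A E ω * u.negPart.1 ω ∂μ := by
    rw [← form_toLinfty, ← hN, hA.isSelfAdjoint, hE, form_toLinfty]
    simp [ProfileInput.one]
  have hsE : eLpNorm (A E) (ENNReal.ofReal s) μ ≤ ENNReal.ofReal r :=
    (eLpNorm_le_eLpNorm_of_exponent_le hs (Lp.aestronglyMeasurable _)).trans
      (A.eLpNorm_apply_one_le hp h)
  have hEs : MemLp (A E) (ENNReal.ofReal s) μ :=
    ⟨Lp.aestronglyMeasurable _, hsE.trans_lt ENNReal.ofReal_lt_top⟩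
  have h3 := integral_mul_le_Lp_mul_Lq_of_nonneg hst hEp
    (ae_of_all μ fun ω => le_max_right (-u.1 ω) 0) hEs
    ((u.negPart.memLp_top μ).mono_exponent (p := ENNReal.ofReal t) le_top)
  have h4 : (∫ ω, A E ω ^ s ∂μ) ^ (1 / s) ≤ r := by
    have e := hEs.eLpNorm_eq_integral_rpow_norm (by simpa using hst.pos) ENNReal.ofReal_ne_top
    rw [e, ENNReal.toReal_ofReal hst.pos.le, ENNReal.ofReal_le_ofReal_iff hr] at hsE
    rw [one_div]
    convert hsE using 2
    refine integral_congr_ae ?_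
    filter_upwards [hEp] with ω hω
    rw [Real.norm_of_nonneg hω]
  -- The negative part lies in `[0,1]` and `t > 1`, so the power only decreases it.
  have h5 : ∫ ω, u.negPart.1 ω ^ t ∂μ ≤ ∫ ω, max (-u.1 ω) 0 ∂μ := by
    refine integral_mono_of_nonneg
      (ae_of_all _ fun ω => Real.rpow_nonneg (le_max_right _ _) _)
      (u.negPart.integrable μ) (ae_of_all _ fun ω => ?_)
    exact Real.rpow_le_self_of_le_one (le_max_right _ _) (u.negPart.2.2 ω).2 hst.symm.lt.le
  have h6 : 0 ≤ ∫ ω, u.negPart.1 ω ^ t ∂μ :=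
    integral_nonneg fun ω => Real.rpow_nonneg (le_max_right _ _) _
  calc _ ≤ _ := h1
    _ = _ := h2
    _ ≤ _ := h3
    _ ≤ _ := by
      refine mul_le_mul h4 (Real.rpow_le_rpow h6 h5 (one_div_nonneg.2 hst.symm.nonneg))
        (Real.rpow_nonneg h6 _) hr

end POperator

/-! ### Transfer between couplings and the underlying spaces -/

namespace POperatorSignal

variable {Ω : Type*} [MeasurableSpace Ω] {μ : Measure Ω} {d k : ℕ}

/-- The random vector `(v₁, …, v_k, Av₁, …, Av_k, f)`. -/
noncomputable def profileVector (X : POperatorSignal μ d) (v : Fin k → ProfileInput Ω) :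
    Ω → ProfileIndex k d → ℝ :=
  fun ω => Sum.elim (fun i => (v i).1 ω)
    (Sum.elim (fun i => X.op ((v i).toLinfty μ) ω) (X.signal ω))

theorem measurable_profileVector (X : POperatorSignal μ d) (v : Fin k → ProfileInput Ω) :
    Measurable (X.profileVector v) := by
  refine measurable_pi_iff.2 ?_
  rintro (i | i | i)
  · exact (v i).2.1
  · exact (Lp.stronglyMeasurable _).measurable
  · exact measurable_pi_iff.1 X.measurable_signal i

theorem integrable_profileVector [IsFiniteMeasure μ] (X : POperatorSignal μ d)
    (v : Fin k → ProfileInput Ω) (i : ProfileIndex k d) :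
    Integrable (fun ω => X.profileVector v ω i) μ := by
  rcases i with (i | i | i)
  · exact (v i).integrable μ
  · exact X.op.integrable_apply _
  · exact .of_bound (measurable_pi_iff.1 X.measurable_signal i).aestronglyMeasurable 1
      (ae_of_all _ fun ω => abs_le.2 (X.signal_mem ω i))

theorem measurePreserving_profileVector (X : POperatorSignal μ d) (v : Fin k → ProfileInput Ω) :
    MeasurePreserving (X.profileVector v) μ (X.pDistribution v) :=
  ⟨X.measurable_profileVector v, rfl⟩

/-- Used with `g` a projection of a coupling: quantities seen by one marginal are computed on the
base space. -/
theorem integral_comp_of_map_eq {Z : Type*} [MeasurableSpace Z] {γ : Measure Z}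
    {X : POperatorSignal μ d} {v : Fin k → ProfileInput Ω} {g : Z → ProfileIndex k d → ℝ}
    (hg : Measurable g) (h : γ.map g = X.pDistribution v) {φ : (ProfileIndex k d → ℝ) → ℝ}
    (hφ : Measurable φ) : ∫ z, φ (g z) ∂γ = ∫ ω, φ (X.profileVector v ω) ∂μ := by
  rw [← integral_map hg.aemeasurable hφ.aestronglyMeasurable, h,
    ← (X.measurePreserving_profileVector v).map_eq,
    integral_map (X.measurable_profileVector v).aemeasurable hφ.aestronglyMeasurable]

theorem integrable_comp_of_map_eq [IsFiniteMeasure μ] {Z : Type*} [MeasurableSpace Z]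
    {γ : Measure Z} {X : POperatorSignal μ d} {v : Fin k → ProfileInput Ω}
    {g : Z → ProfileIndex k d → ℝ} (hg : Measurable g) (h : γ.map g = X.pDistribution v)
    (i : ProfileIndex k d) : Integrable (fun z => g z i) γ := by
  have hi : Measurable fun x : ProfileIndex k d → ℝ => x i := measurable_pi_apply i
  have h1 : Integrable (fun x : ProfileIndex k d → ℝ => x i) (γ.map g) := by
    rw [h, ← (X.measurePreserving_profileVector v).map_eq,
      integrable_map_measure hi.aestronglyMeasurable (X.measurable_profileVector v).aemeasurable]
    exact X.integrable_profileVector v i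
  exact h1.comp_measurable hg

theorem ae_abs_le_one_of_map_eq {Z : Type*} [MeasurableSpace Z]
    {γ : Measure Z} {X : POperatorSignal μ d} {v : Fin k → ProfileInput Ω}
    {g : Z → ProfileIndex k d → ℝ} (hg : Measurable g) (h : γ.map g = X.pDistribution v)
    (i : Fin k) : ∀ᵐ z ∂γ, |g z (Sum.inl i)| ≤ 1 := by
  have hs : MeasurableSet {x : ProfileIndex k d → ℝ | |x (Sum.inl i)| ≤ 1} :=
    measurableSet_le (by fun_prop) measurable_const
  have h1 : ∀ᵐ x ∂(γ.map g), |x (Sum.inl i)| ≤ 1 := by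
    rw [h, ← (X.measurePreserving_profileVector v).map_eq,
      ae_map_iff (X.measurable_profileVector v).aemeasurable hs]
    exact ae_of_all _ fun ω => (v i).abs_le_one ω
  exact (ae_map_iff hg.aemeasurable hs).1 h1

end POperatorSignal

/-! ### Passage to the action limit -/

open POperatorSignal

/-- Along an action convergent sequence, every P-distribution of the limit is coupled with a
P-distribution of some member of the sequence at arbitrarily small `L¹` cost per coordinate. -/
theorem ActionConvergesTo.exists_coupling {Ω' : ℕ → Type*} [∀ n, MeasurableSpace (Ω' n)]
    {μ' : ∀ n, Measure (Ω' n)} [∀ n, IsProbabilityMeasure (μ' n)]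
    {Ω : Type*} [MeasurableSpace Ω] {μ : Measure Ω} [IsProbabilityMeasure μ] {d : ℕ}
    {X : ∀ n, POperatorSignal (μ' n) d} {Y : POperatorSignal μ d} (h : ActionConvergesTo X Y)
    {k : ℕ} (v : Fin k → ProfileInput Ω) {δ : ℝ} (hδ : 0 < δ) :
    ∃ (n : ℕ) (u : Fin k → ProfileInput (Ω' n))
      (γ : Measure ((ProfileIndex k d → ℝ) × (ProfileIndex k d → ℝ))),
      IsProbabilityMeasure γ ∧ γ.map Prod.fst = (X n).pDistribution u ∧
      γ.map Prod.snd = Y.pDistribution v ∧ ∀ i, ∫ z, |z.1 i - z.2 i| ∂γ ≤ δ := by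
  obtain ⟨n, hn⟩ := ((h k).eventually (gt_mem_nhds (ENNReal.ofReal_pos.2 hδ))).exists
  obtain ⟨_, ⟨u, rfl⟩, γ, ⟨h1, h2⟩, hlt⟩ :=
    lintegral_l1EDist_lt_of_profileHausdorffDist_lt hn ⟨v, rfl⟩
  change _ = (X n).pDistribution u at h1
  change _ = Y.pDistribution v at h2
  have hγ : IsProbabilityMeasure γ := by
    constructor
    have : (γ.map Prod.snd) Set.univ = 1 := by
      rw [h2, ← (Y.measurePreserving_profileVector v).map_eq,
        Measure.map_apply (Y.measurable_profileVector v) .univ, Set.preimage_univ, measure_univ]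
    rwa [Measure.map_apply measurable_snd .univ, Set.preimage_univ] at this
  refine ⟨n, u, γ, hγ, h1, h2, fun i => ?_⟩
  have hi : Integrable (fun z => |z.1 i - z.2 i|) γ :=
    ((integrable_comp_of_map_eq measurable_fst h1 i).sub
      (integrable_comp_of_map_eq measurable_snd h2 i)).abs
  rw [← ENNReal.ofReal_le_ofReal_iff hδ.le,
    ofReal_integral_eq_lintegral_ofReal hi (ae_of_all _ fun _ => abs_nonneg _)]
  refine (lintegral_mono fun z => ?_).trans hlt.le
  exact Finset.single_le_sum (f := fun i => ENNReal.ofReal |z.1 i - z.2 i|)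
    (fun _ _ => zero_le) (Finset.mem_univ i)

/-- An action limit of self-adjoint P-operators is self-adjoint. -/
theorem ActionConvergesTo.isSelfAdjoint {Ω' : ℕ → Type*} [∀ n, MeasurableSpace (Ω' n)]
    {μ' : ∀ n, Measure (Ω' n)} [∀ n, IsProbabilityMeasure (μ' n)]
    {Ω : Type*} [MeasurableSpace Ω] {μ : Measure Ω} [IsProbabilityMeasure μ] {d : ℕ}
    {X : ∀ n, POperatorSignal (μ' n) d} {Y : POperatorSignal μ d} (h : ActionConvergesTo X Y)
    (hX : ∀ n, (X n).op.IsSelfAdjoint) : Y.op.IsSelfAdjoint := by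
  refine POperator.isSelfAdjoint_of_profileInput fun u v => ?_
  let w : Fin 2 → ProfileInput Ω := ![v, u]
  have key : ∀ ε : ℝ, 0 < ε → |Y.op.form (v.toLinfty μ) (u.toLinfty μ) -
      Y.op.form (u.toLinfty μ) (v.toLinfty μ)| ≤ 8 * ε := by
    intro ε hε
    choose K hK0 hK using fun i : Fin 2 =>
      exists_integral_max_abs_sub_le (Y.op.integrable_apply ((w i).toLinfty μ)) hε
    -- The levels `K` depend only on the limit, so the accuracy `δ` may be chosen after them, making
    -- each `K i * δ` at most `ε`.
    set δ := ε / (1 + K 0 + K 1)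
    have hpos : 0 < 1 + K 0 + K 1 := by linarith [hK0 0, hK0 1]
    have hδ : 0 < δ := div_pos hε hpos
    have hδε : (1 + K 0 + K 1) * δ = ε := mul_div_cancel₀ _ hpos.ne'
    obtain ⟨n, x, γ, hγ, h1, h2, hcost⟩ := h.exists_coupling w hδ
    have bound : ∀ i j : Fin 2, |(X n).op.form ((x i).toLinfty (μ' n)) ((x j).toLinfty (μ' n)) -
        Y.op.form ((w i).toLinfty μ) ((w j).toLinfty μ)| ≤ δ + K i * δ + 2 * ε := by
      intro i j
      have hφ : Measurable fun y : ProfileIndex 2 d → ℝ => y (.inr (.inl i)) * y (.inl j) := by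
        fun_prop
      have hψ : Measurable fun y : ProfileIndex 2 d → ℝ => max (|y (.inr (.inl i))| - K i) 0 := by
        fun_prop
      have e1 := integral_comp_of_map_eq measurable_fst h1 hφ
      have e2 := integral_comp_of_map_eq measurable_snd h2 hφ
      have e3 := integral_comp_of_map_eq measurable_snd h2 hψ
      have b := abs_integral_mul_sub_integral_mul_le
        (integrable_comp_of_map_eq measurable_fst h1 (.inr (.inl i)))
        (integrable_comp_of_map_eq measurable_snd h2 (.inr (.inl i)))
        (integrable_comp_of_map_eq measurable_fst h1 (.inl j))
        (integrable_comp_of_map_eq measurable_snd h2 (.inl j))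
        (ae_abs_le_one_of_map_eq measurable_fst h1 j)
        (ae_abs_le_one_of_map_eq measurable_snd h2 j) (K i)
      rw [e1, e2, e3] at b
      rw [POperator.form_toLinfty, POperator.form_toLinfty]
      refine b.trans (add_le_add (add_le_add (hcost _) ?_) ?_)
      · exact mul_le_mul_of_nonneg_left (hcost _) (hK0 i)
      · exact mul_le_mul_of_nonneg_left (hK i) zero_le_two
    have b1 := abs_le.1 (bound 0 1)
    have b2 := abs_le.1 (bound 1 0)
    -- After the swap both bounds concern the same number; their sum is at most `6 * ε`.
    rw [hX n] at b1
    have w0 : w 0 = v := rfl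
    have w1 : w 1 = u := rfl
    rw [w0, w1] at b1 b2
    have : 0 ≤ K 0 * δ := mul_nonneg (hK0 0) hδ.le
    have : 0 ≤ K 1 * δ := mul_nonneg (hK0 1) hδ.le
    rw [abs_le]
    constructor <;> linarith [b1.1, b1.2, b2.1, b2.2]
  refine sub_eq_zero.1 (abs_nonpos_iff.1 (le_of_forall_pos_le_add fun ε hε => ?_))
  linarith [key (ε / 8) (by positivity)]

/-- An action limit of graphops with uniformly bounded `(p,q)`-norms, where `q > 1`, is positively
preserving. -/
theorem ActionConvergesTo.isPositivelyPreserving {Ω' : ℕ → Type*} [∀ n, MeasurableSpace (Ω' n)]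
    {μ' : ∀ n, Measure (Ω' n)} [∀ n, IsProbabilityMeasure (μ' n)]
    {Ω : Type*} [MeasurableSpace Ω] {μ : Measure Ω} [IsProbabilityMeasure μ] {d : ℕ}
    {X : ∀ n, POperatorSignal (μ' n) d} {Y : POperatorSignal μ d} (h : ActionConvergesTo X Y)
    {p q : ℝ≥0∞} (hp : 1 ≤ p) (hq : 1 < q) {r : ℝ} (hr : 0 ≤ r)
    (hX : ∀ n, X n ∈ boundedGraphopSignals (μ' n) p q d r) : Y.op.IsPositivelyPreserving := by
  -- A finite exponent `s` covers `q = ∞` as well; `s > 1` makes its conjugate `t` finite.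
  obtain ⟨s, hs1, hsq⟩ : ∃ s : ℝ, 1 < s ∧ ENNReal.ofReal s ≤ q := by
    obtain ⟨s, -, h1, h2⟩ := ENNReal.lt_iff_exists_real_btwn.1 hq
    exact ⟨s, by simpa using h1, h2.le⟩
  have hst := Real.HolderConjugate.conjExponent hs1
  set t := s.conjExponent
  refine POperator.isPositivelyPreserving_of_profileInput fun v hv => ?_
  have key : ∀ δ : ℝ, 0 < δ → ∫ ω, max (-Y.op (v.toLinfty μ) ω) 0 ∂μ ≤ r * δ ^ (1 / t) + δ := by
    intro δ hδ
    obtain ⟨n, u, γ, hγ, h1, h2, hcost⟩ := h.exists_coupling (fun _ : Fin 1 => v) hδ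
    have hφ : ∀ i, Measurable fun y : ProfileIndex 1 d → ℝ => max (-y i) 0 := fun i => by fun_prop
    have b1 := integral_max_neg_le (integrable_comp_of_map_eq measurable_fst h1 (.inl 0))
      (integrable_comp_of_map_eq measurable_snd h2 (.inl 0))
    -- The roles are reversed relative to `b1`: inputs pass from the limit to the approximant,
    -- images pass back.
    have b2 := integral_max_neg_le (integrable_comp_of_map_eq measurable_snd h2 (.inr (.inl 0)))
      (integrable_comp_of_map_eq measurable_fst h1 (.inr (.inl 0)))
    rw [integral_comp_of_map_eq measurable_fst h1 (hφ _),
      integral_comp_of_map_eq measurable_snd h2 (hφ _)] at b1 b2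
    have hv0 : ∫ ω, max (-v.1 ω) 0 ∂μ = 0 := integral_eq_zero_of_ae <| by
      filter_upwards [hv] with ω hω
      exact max_eq_right (neg_nonpos.2 hω)
    have hu : ∫ ω, max (-(u 0).1 ω) 0 ∂(μ' n) ≤ δ := by
      refine b1.trans ((add_le_add hv0.le (hcost _)).trans (zero_add δ).le)
    have hA := (hX n).1.integral_max_neg_apply_le hp hr (hX n).2 hst hsq (u 0)
    have hmono := Real.rpow_le_rpow (integral_nonneg fun ω => le_max_right _ _) hu
      (one_div_nonneg.2 hst.symm.nonneg)
    refine b2.trans (add_le_add (hA.trans (mul_le_mul_of_nonneg_left hmono hr)) ?_)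
    exact (integral_congr_ae (ae_of_all _ fun z => abs_sub_comm _ _)).trans_le (hcost _)
  have hlim : Tendsto (fun δ : ℝ => r * δ ^ (1 / t) + δ) (𝓝[>] 0) (𝓝 0) := by
    have hc : Continuous fun δ : ℝ => r * δ ^ (1 / t) + δ :=
      ((Real.continuous_rpow_const (one_div_nonneg.2 hst.symm.nonneg)).const_mul r).add
        continuous_id
    have := hc.tendsto 0
    rw [Real.zero_rpow (one_div_pos.2 hst.symm.pos).ne', mul_zero, zero_add] at this
    exact this.mono_left nhdsWithin_le_nhds
  have hle : ∫ ω, max (-Y.op (v.toLinfty μ) ω) 0 ∂μ ≤ 0 :=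
    ge_of_tendsto hlim (eventually_nhdsWithin_of_forall key)
  have h0 := (integral_eq_zero_iff_of_nonneg (fun ω => le_max_right _ _)
    (Y.op.integrable_apply (v.toLinfty μ)).neg.pos_part).1
    (hle.antisymm (integral_nonneg fun ω => le_max_right _ _))
  filter_upwards [h0] with ω hω
  exact neg_nonpos.1 ((le_max_left _ _).trans hω.le)

theorem mainTheorem7 (p q : ℝ≥0∞) (hp : 1 ≤ p) (hq : 1 < q) (d : ℕ) (r : ℝ) (hr : 0 < r)
    {Ω' : ℕ → Type*} [∀ n, MeasurableSpace (Ω' n)]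
    (μ' : ∀ n, Measure (Ω' n)) [∀ n, IsProbabilityMeasure (μ' n)]
    {Ω : Type*} [MeasurableSpace Ω] (μ : Measure Ω) [IsProbabilityMeasure μ]
    (X : ∀ n, POperatorSignal (μ' n) d) (Y : POperatorSignal μ d)
    (hX : ∀ n, X n ∈ boundedGraphopSignals (μ' n) p q d r)
    (hY : Y ∈ boundedPOperatorSignals μ p q d r)
    (hconv : ActionConvergesTo X Y) :
    Y ∈ boundedGraphopSignals μ p q d r := by
  exact ⟨⟨hconv.isSelfAdjoint fun n => (hX n).1.isSelfAdjoint,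
    hconv.isPositivelyPreserving hp hq hr.le hX⟩, hY⟩
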